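/- Let $d\ge 1$, $1<p<\infty$ and $\varepsilon_0>0$. There is a constant $C=C(d,p,\varepsilon_0)<\infty$ such that the following holds. Let $\varepsilon:[1,\infty)\to(0,\infty)$ be a monotone increasing (i.e. non-decreasing) function with $\varepsilon(1)\ge\varepsilon_0$ and $$\int_1^\infty \frac{dt}{\varepsilon(t)\,t}=1,$$ and let $\sigma,w$ be two weights on $\mathbb R^d$, that is, non-negative locally integrable functions. Then $$\bigl\| M_\sigma : L^p(\sigma)\to L^p(w)\bigr\| \;\le\; C\,\lceil \sigma,w\rceil_{p,\varepsilon}^{1/p},$$ that is, $\|M(\sigma f)\|_{L^p(w)}\le C\,\lceil \sigma,w\rceil_{p,\varepsilon}^{1/p}\,\|f\|_{L^p(\sigma)}$ for all $f\in L^p(\sigma)=L^p(\mathbb R^d,\sigma\,dx)$. Here cubes have sides parallel to the axes and positive side length, $\langle f\rangle_Q=|Q|^{-1}\int_Q f\,dx$, $\sigma(Q)=\int_Q\sigma\,dx$, $Mf(x)=\sup_{Q\ni x}\langle |f|\rangle_Q$ is the maximal function (supremum over all cubes containing $x$), $M_\sigma f=M(\sigma f)$, and $$\rho_\sigma(Q)=\frac{\int_Q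 M(\sigma\mathbf 1_Q)\,dx}{\sigma(Q)},\qquad \rho_{\sigma,\varepsilon}(Q)=\rho_\sigma(Q)\,\varepsilon(\rho_\sigma(Q)),\qquad \lceil\sigma,w\rceil_{p,\varepsilon}=\sup_{Q}\ \rho_{\sigma,\varepsilon}(Q)\,\langle\sigma\rangle_Q^{p-1}\,\langle w\rangle_Q .$$ The supremum is over all cubes $Q$; the product is read as $0$ if $\sigma(Q)=0$ or $w(Q)=0$, and $\rho_{\sigma,\varepsilon}(Q)=\infty$ if $\rho_\sigma(Q)=\infty$. -/

import Mathlib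

open MeasureTheory Set
open scoped ENNReal NNReal

noncomputable section

/-- A weight on `ℝ^d`: a non-negative locally integrable density. -/
structure IsWeight {d : ℕ} (σ : (Fin d → ℝ) → ℝ) : Prop where
  nonneg : ∀ x, 0 ≤ σ x
  locallyIntegrable : LocallyIntegrable σ volume

/-- The measure `σ dx` with density `σ`. -/
def weightMeasure {d : ℕ} (σ : (Fin d → ℝ) → ℝ) : Measure (Fin d → ℝ) :=
  volume.withDensity (fun x => ENNReal.ofReal (σ x))

/-- A cube in `ℝ^d` with sides parallel to the axes, of positive side length. -/
structure Cube (d : ℕ) where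
  corner : Fin d → ℝ
  side : ℝ
  side_pos : 0 < side

/-- The set of points of a cube, `∏ i, [a i, a i + ℓ]`. -/
def Cube.toSet {d : ℕ} (Q : Cube d) : Set (Fin d → ℝ) :=
  Icc Q.corner (fun i => Q.corner i + Q.side)

/-- The average `⟨|f|⟩_Q = |Q|⁻¹ ∫_Q |f| dx`, in `[0, ∞]`. -/
def cubeAverage {d : ℕ} (f : (Fin d → ℝ) → ℝ) (Q : Cube d) : ℝ≥0∞ :=
  ⨍⁻ x in Q.toSet, ‖f x‖ₑ ∂volume

/-- The (Hardy–Littlewood) maximal function over cubes,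
`M f (x) = sup {⟨|f|⟩_Q : Q a cube containing x}`. -/
def maximalFunction {d : ℕ} (f : (Fin d → ℝ) → ℝ) (x : Fin d → ℝ) : ℝ≥0∞ :=
  ⨆ (Q : Cube d) (_ : x ∈ Q.toSet), cubeAverage f Q

/-- `ρ_σ(Q) = (∫_Q M(σ 1_Q) dx) / σ(Q)`, in `[0, ∞]`. For a weight it lies in `[1, ∞]` if
`σ(Q) > 0`; if `σ(Q) = 0`, it is `0 / 0 = 0`. -/
def rho {d : ℕ} (σ : (Fin d → ℝ) → ℝ) (Q : Cube d) : ℝ≥0∞ :=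
  (∫⁻ x in Q.toSet, maximalFunction (Q.toSet.indicator σ) x ∂volume) / weightMeasure σ Q.toSet

open Classical in
/-- `ρ_{σ,ε}(Q) = ρ_σ(Q) ε(ρ_σ(Q))`, which is `∞` if `ρ_σ(Q) = ∞`. -/
def rhoEps {d : ℕ} (σ : (Fin d → ℝ) → ℝ) (ε : ℝ → ℝ) (Q : Cube d) : ℝ≥0∞ :=
  if rho σ Q = ∞ then ∞ else rho σ Q * ENNReal.ofReal (ε (rho σ Q).toReal)

/-- The entropy bump constant
`⌈σ, w⌉_{p,ε} = sup_Q ρ_{σ,ε}(Q) ⟨σ⟩_Q^{p-1} ⟨w⟩_Q`, in `[0, ∞]`. -/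
def entropyBump {d : ℕ} (σ w : (Fin d → ℝ) → ℝ) (p : ℝ) (ε : ℝ → ℝ) : ℝ≥0∞ :=
  ⨆ Q : Cube d, rhoEps σ ε Q * cubeAverage σ Q ^ (p - 1) * cubeAverage w Q

/-- The norm of `M_σ : L^p(σ) → L^p(w)`, where `M_σ f = M(σ f)`: the least `N` in `[0, ∞]` with
`‖M(σ f)‖_{L^p(w)} ≤ N ‖f‖_{L^p(σ)}` for all `f ∈ L^p(σ)`. -/
def maximalOpNorm {d : ℕ} (σ w : (Fin d → ℝ) → ℝ) (p : ℝ) : ℝ≥0∞ :=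
  sInf {N : ℝ≥0∞ | ∀ f : (Fin d → ℝ) → ℝ,
    MemLp f (ENNReal.ofReal p) (weightMeasure σ) →
      eLpNorm (maximalFunction (fun x => σ x * f x)) (ENNReal.ofReal p) (weightMeasure w) ≤
        N * eLpNorm f (ENNReal.ofReal p) (weightMeasure σ)}

end

/-!
The proof is direct and does not pass through a testing theorem. By the one-third trick
(`maximalFunction_le`) it suffices to bound the maximal function of each of `2 ^ d` shifted dyadic
grids, and by monotone convergence the maximal function over a finite family `F` of dyadic cubes,
uniformly in `F`.

Write `m A` for the `σ`-average of `|f|` over `A`, so that the Lebesgue average of `σ |f|` is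
`m A * ⟨σ⟩_A`. Selecting principal cubes (`exists_principal`) gives `S ⊆ F` that is sparse with
respect to Lebesgue measure and satisfies
`∫ (max_{A ∈ F} 1_A ⟨σ |f|⟩_A)^p w ≤ 2^p ∑_{A ∈ S} (m A)^p ⟨σ⟩_A^p w(A)`. The bump condition on `A`
turns `⟨σ⟩_A^p w(A)` into `K a_A`, where `K = ⌈σ, w⌉_{p,ε}` and `a_A = σ(A) / ρ_{σ,ε}(A)`. By the
Carleson embedding theorem (`sum_mul_average_rpow_le`), the sum is at most a constant times
`K ∫ |f|^p σ` once the coefficients satisfy `∑_{A ⊆ X} a_A ≤ c σ(X)` for `X ∈ S`.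

This packing condition is where the entropy enters. Sparsity and the definition of `ρ_σ` give
`∑_{A ⊆ R} σ(A) ≤ 2 ∫_R M(σ 1_R) = 2 ρ_σ(R) σ(R)` (`IsWeight.sum_le_rho_mul`). On the layer where
`ρ_σ` is comparable to `2^k` this loses a factor `2^k`, which the factor `ρ_σ` in the bump repays;
there remains `∑_k 1 / ε(2^k)`, controlled by the integral condition on `ε`
(`sum_le_of_layers`, `tsum_inv_le_of_lintegral_eq_one`).

The Carleson embedding is reduced, by a second selection of principal sets, to sets along which
`m` doubles. There the sum `X = ∑ (m A)^p σ(A) = ∫ |f| ∑ (m A)^{p-1} 1_A dσ` satisfies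
`X ≤ C ‖f‖_p X^{1/p'}`, because the inner sum is geometric at every point
(`sum_average_rpow_le_of_doubling`).
-/

/-! ### Finite laminar families -/

/-- A family of sets is laminar if any two members are nested or disjoint, as dyadic cubes are. -/
def IsLaminar {α : Type*} (F : Set (Set α)) : Prop :=
  ∀ A ∈ F, ∀ B ∈ F, A ⊆ B ∨ B ⊆ A ∨ Disjoint A B

theorem IsLaminar.mono {α : Type*} {F G : Set (Set α)} (hG : IsLaminar G) (h : F ⊆ G) :
    IsLaminar F := fun A hA B hB => hG A (h hA) B (h hB)

/-- Selection of principal sets: `S` dominates the values of `v` on `F` up to a factor `2`, while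
along strict inclusions in `S` the value of `v` more than doubles. -/
theorem exists_principal {α : Type*} (F : Finset (Set α)) (v : Set α → ℝ≥0∞) :
    ∃ S ⊆ F, (∀ A ∈ S, v A ≠ 0) ∧ (∀ A ∈ F, v A ≠ 0 → ∃ R ∈ S, A ⊆ R ∧ v A ≤ 2 * v R) ∧
      ∀ A ∈ S, ∀ B ∈ S, B ⊂ A → 2 * v A < v B := by
  classical
  induction F using Finset.strongInduction with
  | H F ih =>
    rcases F.eq_empty_or_nonempty with rfl | hne
    · exact ⟨∅, by simp, by simp, by simp, by simp⟩
    obtain ⟨Q, hQ⟩ := F.exists_minimal hne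
    obtain ⟨S, hSF, h0, hdom, hdbl⟩ := ih (F.erase Q) (Finset.erase_ssubset hQ.prop)
    have hSF' : S ⊆ F := hSF.trans (Finset.erase_subset _ _)
    by_cases hc : v Q = 0 ∨ ∃ R ∈ S, Q ⊆ R ∧ v Q ≤ 2 * v R
    · refine ⟨S, hSF', h0, fun A hA hvA => ?_, hdbl⟩
      by_cases hAQ : A = Q
      · subst hAQ
        exact hc.resolve_left hvA
      · exact hdom A (Finset.mem_erase.2 ⟨hAQ, hA⟩) hvA
    · push Not at hc
      refine ⟨insert Q S, Finset.insert_subset hQ.prop hSF', ?_, fun A hA hvA => ?_, ?_⟩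
      · intro A hA
        rcases Finset.mem_insert.1 hA with rfl | hA
        exacts [hc.1, h0 A hA]
      · by_cases hAQ : A = Q
        · subst hAQ
          refine ⟨A, Finset.mem_insert_self _ _, Subset.rfl, ?_⟩
          exact le_mul_of_one_le_left (zero_le) (by norm_num)
        · obtain ⟨R, hR, h⟩ := hdom A (Finset.mem_erase.2 ⟨hAQ, hA⟩) hvA
          exact ⟨R, Finset.mem_insert_of_mem hR, h⟩
      · intro A hA B hB hBA
        rcases Finset.mem_insert.1 hA with rfl | hAS
        · have hBF : B ∈ F := by
            rcases Finset.mem_insert.1 hB with rfl | hB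
            exacts [hQ.prop, hSF' hB]
          exact absurd (hQ.le_of_le hBF hBA.subset) hBA.not_subset
        · rcases Finset.mem_insert.1 hB with rfl | hB
          · exact hc.2 A hAS hBA.subset
          · exact hdbl A hAS B hB hBA

/-- The maximal members of a finite laminar family are disjoint and cover it. -/
theorem exists_disjoint_cover {α : Type*} (F : Finset (Set α)) (hF : IsLaminar (F : Set (Set α))) :
    ∃ T ⊆ F, (T : Set (Set α)).PairwiseDisjoint id ∧ ∀ A ∈ F, ∃ R ∈ T, A ⊆ R := by
  classical
  refine ⟨F.filter (Maximal (· ∈ F)), Finset.filter_subset _ _, ?_, ?_⟩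
  · intro A hA B hB hAB
    simp only [Finset.coe_filter, mem_ofPred_eq] at hA hB
    rcases hF A hA.1 B hB.1 with h | h | h
    · exact absurd (hA.2.eq_of_le hB.1 h) hAB
    · exact absurd (hB.2.eq_of_le hA.1 h).symm hAB
    · exact h
  · intro A hA
    obtain ⟨R, hAR, hR⟩ := F.exists_le_maximal hA
    exact ⟨R, Finset.mem_filter.2 ⟨hR.prop, hR⟩, hAR⟩

/-- The part of `A` not covered by the members of `S` strictly inside `A`. -/
def exclusivePart {α : Type*} (S : Finset (Set α)) (A : Set α) : Set α :=
  A \ ⋃ B ∈ {B | B ∈ S ∧ B ⊂ A}, B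

theorem exclusivePart_subset {α : Type*} (S : Finset (Set α)) (A : Set α) :
    exclusivePart S A ⊆ A := sdiff_subset

theorem pairwiseDisjoint_exclusivePart {α : Type*} (S : Finset (Set α))
    (hS : IsLaminar (S : Set (Set α))) :
    (S : Set (Set α)).PairwiseDisjoint (exclusivePart S) := by
  intro A hA B hB hAB
  refine Set.disjoint_left.2 fun x hxA hxB => ?_
  rcases hS A hA B hB with h | h | h
  · exact hxB.2 (mem_biUnion (show A ∈ {C | C ∈ S ∧ C ⊂ B} from ⟨hA, h.ssubset_of_ne hAB⟩) hxA.1)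
  · exact hxA.2
      (mem_biUnion (show B ∈ {C | C ∈ S ∧ C ⊂ A} from ⟨hB, h.ssubset_of_ne hAB.symm⟩) hxB.1)
  · exact Set.disjoint_left.1 h hxA.1 hxB.1

section Measure

variable {α : Type*} [MeasurableSpace α]

theorem measurableSet_exclusivePart {S : Finset (Set α)} (hm : ∀ A ∈ S, MeasurableSet A)
    {A : Set α} (hA : A ∈ S) : MeasurableSet (exclusivePart S A) := by
  refine (hm A hA).diff (MeasurableSet.biUnion ?_ fun B hB => hm B hB.1)
  exact (S.finite_toSet.subset fun B hB => hB.1).countable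

theorem sum_measure_le_of_disjoint (ν : Measure α) {T : Finset (Set α)} {X : Set α}
    (hd : (T : Set (Set α)).PairwiseDisjoint id) (hm : ∀ A ∈ T, MeasurableSet A)
    (hX : ∀ A ∈ T, A ⊆ X) : ∑ A ∈ T, ν A ≤ ν X := by
  have := measure_biUnion_finset (μ := ν) hd hm
  simp only [id] at this
  rw [← this]
  exact measure_mono (iUnion₂_subset hX)

/-- If the quotients `ν A / μ A` more than double along strict inclusions in `S`, then `S` is
sparse: each exclusive part carries at least half of the `μ`-measure. -/
theorem measure_le_two_mul_exclusivePart (μ ν : Measure α) (S : Finset (Set α))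
    (hS : IsLaminar (S : Set (Set α))) (hm : ∀ A ∈ S, MeasurableSet A)
    (hμ0 : ∀ A ∈ S, μ A ≠ 0) (hμ : ∀ A ∈ S, μ A ≠ ∞) (hν : ∀ A ∈ S, ν A ≠ ∞)
    (hν0 : ∀ A ∈ S, ν A / μ A ≠ 0)
    (hdbl : ∀ A ∈ S, ∀ B ∈ S, B ⊂ A → 2 * (ν A / μ A) < ν B / μ B) {A : Set α} (hA : A ∈ S) :
    μ A ≤ 2 * μ (exclusivePart S A) := by
  classical
  set S' := S.filter (· ⊂ A) with hS'
  obtain ⟨T, hTS, hTd, hTc⟩ := exists_disjoint_cover S'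
    (hS.mono (by intro B hB; exact (Finset.mem_filter.1 hB).1))
  have hT : ∀ B ∈ T, B ∈ S ∧ B ⊂ A := fun B hB => Finset.mem_filter.1 (hTS hB)
  set U : Set α := ⋃ B ∈ {B | B ∈ S ∧ B ⊂ A}, B with hU
  have hUT : U ⊆ ⋃ B ∈ T, B := by
    refine iUnion₂_subset fun B hB => ?_
    obtain ⟨R, hR, hBR⟩ := hTc B (Finset.mem_filter.2 hB)
    exact hBR.trans (subset_biUnion_of_mem (u := fun B => B) hR)
  have hUm : MeasurableSet U := by
    refine MeasurableSet.biUnion ?_ fun B hB => hm B hB.1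
    exact (S.finite_toSet.subset fun B hB => hB.1).countable
  have hUA : U ⊆ A := iUnion₂_subset fun B hB => hB.2.subset
  set q := ν A / μ A with hq
  have hqt : q ≠ ∞ := ENNReal.div_ne_top (hν A hA) (hμ0 A hA)
  have hqA : q * μ A = ν A := ENNReal.div_mul_cancel (hμ0 A hA) (hμ A hA)
  have key : q * (2 * μ U) ≤ q * μ A := by
    calc q * (2 * μ U) ≤ q * (2 * ∑ B ∈ T, μ B) := by
          gcongr
          exact (measure_mono hUT).trans (measure_biUnion_finset_le _ _)
      _ = ∑ B ∈ T, 2 * q * μ B := by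
          rw [Finset.mul_sum, Finset.mul_sum]
          simp only [mul_left_comm, mul_assoc]
      _ ≤ ∑ B ∈ T, ν B := by
          refine Finset.sum_le_sum fun B hB => ?_
          calc 2 * q * μ B ≤ ν B / μ B * μ B := by
                gcongr; exact (hdbl A hA B (hT B hB).1 (hT B hB).2).le
            _ = ν B := ENNReal.div_mul_cancel (hμ0 B (hT B hB).1) (hμ B (hT B hB).1)
      _ ≤ ν A := sum_measure_le_of_disjoint ν hTd (fun B hB => hm B (hT B hB).1)
          fun B hB => (hT B hB).2.subset
      _ = q * μ A := hqA.symm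
  have key2 : 2 * μ U ≤ μ A := (ENNReal.mul_le_mul_iff_right (hν0 A hA) hqt).1 key
  have hsplit : μ A = μ U + μ (exclusivePart S A) := by
    rw [exclusivePart, ← hU]
    have := measure_inter_add_sdiff (μ := μ) A hUm
    rwa [inter_eq_self_of_subset_right hUA, eq_comm] at this
  have hUt : μ U ≠ ∞ := ne_top_of_le_ne_top (hμ A hA) (measure_mono hUA)
  rw [hsplit, two_mul] at key2
  have : μ U ≤ μ (exclusivePart S A) := (ENNReal.add_le_add_iff_left hUt).1 key2
  rw [hsplit, two_mul]
  gcongr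

open Classical in
/-- A packing bound that holds below each member of a finite laminar family holds below any set
that contains the family. -/
theorem sum_le_of_packing (σ : Measure α) (T : Finset (Set α)) (hT : IsLaminar (T : Set (Set α)))
    (hm : ∀ A ∈ T, MeasurableSet A) (X : Set α) (hX : ∀ A ∈ T, A ⊆ X) (b : Set α → ℝ≥0∞)
    (c : ℝ≥0∞) (hb : ∀ R ∈ T, ∑ A ∈ T with A ⊆ R, b A ≤ c * σ R) :
    ∑ A ∈ T, b A ≤ c * σ X := by
  obtain ⟨T', hTT, hd, hc⟩ := exists_disjoint_cover T hT
  calc ∑ A ∈ T, b A ≤ ∑ A ∈ T, ∑ R ∈ T' with A ⊆ R, b A := by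
        refine Finset.sum_le_sum fun A hA => ?_
        obtain ⟨R, hR, hAR⟩ := hc A hA
        exact Finset.single_le_sum (f := fun _ => b A) (fun _ _ => zero_le)
          (Finset.mem_filter.2 ⟨hR, hAR⟩)
    _ = ∑ R ∈ T', ∑ A ∈ T with A ⊆ R, b A := by
        simp only [Finset.sum_filter]
        exact Finset.sum_comm
    _ ≤ ∑ R ∈ T', c * σ R := Finset.sum_le_sum fun R hR => hb R (hTT hR)
    _ = c * ∑ R ∈ T', σ R := by rw [Finset.mul_sum]
    _ ≤ c * σ X := by
        gcongr
        exact sum_measure_le_of_disjoint σ hd (fun A hA => hm A (hTT hA)) fun A hA => hX A (hTT hA)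

end Measure

/-- A sum of geometrically separated terms is comparable to its largest term. -/
theorem exists_sum_le_of_geometric {ι : Type*} (θ : ℝ≥0∞) (hθ : θ < 1) (s : Finset ι)
    (g : ι → ℝ≥0∞) (h : ∀ i ∈ s, ∀ j ∈ s, i ≠ j → g i ≤ θ * g j ∨ g j ≤ θ * g i)
    (hs : s.Nonempty) : ∃ j ∈ s, ∑ i ∈ s, g i ≤ (1 - θ)⁻¹ * g j := by
  classical
  induction s using Finset.strongInduction with
  | H s ih =>
    obtain ⟨j, hj, hmax⟩ := s.exists_max_image g hs
    refine ⟨j, hj, ?_⟩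
    have h1θ : (1 - θ) ≠ 0 := (tsub_pos_of_lt hθ).ne'
    have h1θ' : (1 - θ) ≠ ∞ := ne_top_of_le_ne_top ENNReal.one_ne_top tsub_le_self
    have hid : (1 - θ)⁻¹ = 1 + (1 - θ)⁻¹ * θ := by
      calc (1 - θ)⁻¹ = (1 - θ)⁻¹ * ((1 - θ) + θ) := by rw [tsub_add_cancel_of_le hθ.le, mul_one]
        _ = 1 + (1 - θ)⁻¹ * θ := by rw [mul_add, ENNReal.inv_mul_cancel h1θ h1θ']
    rw [← Finset.add_sum_erase s g hj, hid, add_mul, one_mul]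
    gcongr
    rcases (s.erase j).eq_empty_or_nonempty with he | hne
    · simp [he]
    obtain ⟨j', hj', hle⟩ := ih (s.erase j) (Finset.erase_ssubset hj)
      (fun i hi k hk => h i (Finset.mem_of_mem_erase hi) k (Finset.mem_of_mem_erase hk)) hne
    refine hle.trans ?_
    rw [mul_assoc]
    gcongr
    have hj's := Finset.mem_of_mem_erase hj'
    rcases h j' hj's j hj (Finset.ne_of_mem_erase hj') with h' | h'
    · exact h'
    · calc g j' ≤ g j := hmax j' hj's
        _ ≤ θ * g j' := h'
        _ ≤ θ * g j := by gcongr; exact hmax j' hj's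

/-! ### The Carleson embedding theorem and packing -/

/-- The constant `(1 - 2^{-(p-1)})⁻¹`, the sum of the geometric series of ratio `2^{-(p-1)}`. -/
noncomputable def geomConst (p : ℝ) : ℝ≥0∞ := (1 - ((2 : ℝ≥0∞) ^ (p - 1))⁻¹)⁻¹

theorem geomRatio_lt_one {p : ℝ} (hp : 1 < p) : ((2 : ℝ≥0∞) ^ (p - 1))⁻¹ < 1 :=
  ENNReal.inv_lt_one.2 (ENNReal.one_lt_rpow (by norm_num) (by linarith))

theorem geomConst_ne_top {p : ℝ} (hp : 1 < p) : geomConst p ≠ ∞ :=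
  ENNReal.inv_ne_top.2 (tsub_pos_of_lt (geomRatio_lt_one hp)).ne'

/-- Along the chain of members of `P` through a point, powers of `v` sum geometrically. -/
theorem sum_indicator_rpow_le {α : Type*} {p : ℝ} (hp : 1 < p) (P : Finset (Set α))
    (hP : IsLaminar (P : Set (Set α))) (v : Set α → ℝ≥0∞)
    (hdbl : ∀ A ∈ P, ∀ B ∈ P, B ⊂ A → 2 * v A < v B) (x : α) :
    (∑ A ∈ P, A.indicator (fun _ => v A ^ (p - 1)) x) ^ p.conjExponent ≤
      geomConst p ^ p.conjExponent * ∑ A ∈ P, A.indicator (fun _ => v A ^ p) x := by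
  classical
  have hpq := Real.HolderConjugate.conjExponent hp
  have hp1 : 0 < p - 1 := by linarith
  set θ : ℝ≥0∞ := ((2 : ℝ≥0∞) ^ (p - 1))⁻¹ with hθ
  have hsum : ∀ q : ℝ, ∑ A ∈ P, A.indicator (fun _ => v A ^ q) x =
      ∑ A ∈ P with x ∈ A, v A ^ q := by
    intro q
    rw [Finset.sum_filter]
    exact Finset.sum_congr rfl fun A _ => by simp only [indicator_apply]
  rw [hsum, hsum]
  rcases (P.filter (x ∈ ·)).eq_empty_or_nonempty with he | hne
  · rw [he]; simp [hpq.symm.pos]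
  have hstep : ∀ A ∈ P, ∀ B ∈ P, B ⊂ A → v A ^ (p - 1) ≤ θ * v B ^ (p - 1) := by
    intro A hA B hB hBA
    have h2 : (2 : ℝ≥0∞) ^ (p - 1) ≠ 0 := by simp
    have h2' : (2 : ℝ≥0∞) ^ (p - 1) ≠ ∞ := ENNReal.rpow_ne_top_of_nonneg hp1.le (by simp)
    calc v A ^ (p - 1) = θ * (2 * v A) ^ (p - 1) := by
          rw [ENNReal.mul_rpow_of_nonneg _ _ hp1.le, ← mul_assoc, hθ,
            ENNReal.inv_mul_cancel h2 h2', one_mul]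
      _ ≤ θ * v B ^ (p - 1) := by gcongr; exact (hdbl A hA B hB hBA).le
  obtain ⟨R, hR, hle⟩ := exists_sum_le_of_geometric θ (geomRatio_lt_one hp) (P.filter (x ∈ ·))
    (fun A => v A ^ (p - 1)) (by
      intro A hA B hB hAB
      rw [Finset.mem_filter] at hA hB
      rcases hP A hA.1 B hB.1 with h | h | h
      · exact Or.inr (hstep B hB.1 A hA.1 (h.ssubset_of_ne hAB))
      · exact Or.inl (hstep A hA.1 B hB.1 (h.ssubset_of_ne hAB.symm))
      · exact absurd hB.2 (Set.disjoint_left.1 h hA.2)) hne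
  calc (∑ A ∈ P with x ∈ A, v A ^ (p - 1)) ^ p.conjExponent
      ≤ (geomConst p * v R ^ (p - 1)) ^ p.conjExponent :=
        ENNReal.rpow_le_rpow hle hpq.symm.nonneg
    _ = geomConst p ^ p.conjExponent * v R ^ p := by
        rw [ENNReal.mul_rpow_of_nonneg _ _ hpq.symm.nonneg, ← ENNReal.rpow_mul]
        congr 2
        rw [Real.conjExponent]; field_simp
    _ ≤ _ := by
        gcongr
        exact Finset.single_le_sum (f := fun A => v A ^ p) (fun _ _ => zero_le) hR

section

variable {α : Type*} [MeasurableSpace α]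

/-- The `L^p(σ)` bound for averages over sets along which these averages double. By Hölder, the
sum `X` on the left satisfies `X ≤ C ‖f‖_p X^{1/p'}`, and `X` is finite. -/
theorem sum_average_rpow_le_of_doubling {p : ℝ} (hp : 1 < p) (σ : Measure α) (P : Finset (Set α))
    (hP : IsLaminar (P : Set (Set α))) (hm : ∀ A ∈ P, MeasurableSet A)
    (hσ : ∀ A ∈ P, σ A ≠ ∞) (f : α → ℝ≥0∞) (hf : AEMeasurable f σ)
    (hfin : ∀ A ∈ P, ∫⁻ x in A, f x ∂σ ≠ ∞)
    (hdbl : ∀ A ∈ P, ∀ B ∈ P, B ⊂ A →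
      2 * ((∫⁻ x in A, f x ∂σ) / σ A) < (∫⁻ x in B, f x ∂σ) / σ B) :
    ∑ A ∈ P, ((∫⁻ x in A, f x ∂σ) / σ A) ^ p * σ A ≤
      geomConst p ^ p * ∫⁻ x, f x ^ p ∂σ := by
  have hpq := Real.HolderConjugate.conjExponent hp
  have hp0 : 0 < p := by linarith
  have hp1 : 0 < p - 1 := by linarith
  set m : Set α → ℝ≥0∞ := fun A => (∫⁻ x in A, f x ∂σ) / σ A with hmdef
  set q := p.conjExponent with hq
  change ∑ A ∈ P, m A ^ p * σ A ≤ _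
  set X := ∑ A ∈ P, m A ^ p * σ A with hX
  have hmt : ∀ A ∈ P, m A ≠ ∞ := by
    intro A hA
    by_cases h0 : σ A = 0
    · simp [hmdef, h0, Measure.restrict_eq_zero.2 h0]
    · exact ENNReal.div_ne_top (hfin A hA) h0
  have hXt : X ≠ ∞ := ENNReal.sum_ne_top.2 fun A hA =>
    ENNReal.mul_ne_top (ENNReal.rpow_ne_top_of_nonneg hp0.le (hmt A hA)) (hσ A hA)
  by_cases hX0 : X = 0
  · rw [hX0]; exact zero_le
  set G : α → ℝ≥0∞ := fun x => ∑ A ∈ P, A.indicator (fun _ => m A ^ (p - 1)) x with hG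
  have hGm : Measurable G :=
    Finset.measurable_fun_sum _ fun A hA => measurable_const.indicator (hm A hA)
  have h1 : X ≤ ∫⁻ x, (f * G) x ∂σ := by
    have : ∀ x, (f * G) x = ∑ A ∈ P, A.indicator (fun y => m A ^ (p - 1) * f y) x := by
      intro x
      simp only [Pi.mul_apply, hG, Finset.mul_sum]
      refine Finset.sum_congr rfl fun A _ => ?_
      by_cases hx : x ∈ A <;> simp [hx, mul_comm]
    simp only [this]
    rw [lintegral_finsetSum' _ fun A hA => (hf.const_mul _).indicator (hm A hA)]
    refine Finset.sum_le_sum fun A hA => ?_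
    rw [lintegral_indicator (hm A hA), lintegral_const_mul'' _ hf.restrict]
    calc m A ^ p * σ A = m A ^ (p - 1) * (m A * σ A) := by
          rw [← mul_assoc]
          congr 1
          conv_lhs => rw [show p = (p - 1) + 1 by ring]
          rw [ENNReal.rpow_add_of_nonneg _ _ hp1.le zero_le_one, ENNReal.rpow_one]
      _ ≤ _ := by
          gcongr
          exact ENNReal.mul_le_of_le_div le_rfl
  have h2 : ∫⁻ x, G x ^ q ∂σ ≤ geomConst p ^ q * X := by
    calc ∫⁻ x, G x ^ q ∂σ
        ≤ ∫⁻ x, geomConst p ^ q * ∑ A ∈ P, A.indicator (fun _ => m A ^ p) x ∂σ :=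
          lintegral_mono fun x => sum_indicator_rpow_le hp P hP m hdbl x
      _ = geomConst p ^ q * X := by
          rw [lintegral_const_mul _ (Finset.measurable_fun_sum _ fun A hA =>
            measurable_const.indicator (hm A hA)), lintegral_finsetSum _ fun A hA =>
            measurable_const.indicator (hm A hA)]
          congr 1
          exact Finset.sum_congr rfl fun A hA => lintegral_indicator_const (hm A hA) _
  have h3 : X ≤ (geomConst p * (∫⁻ x, f x ^ p ∂σ) ^ (1 / p)) * X ^ (1 / q) := by
    calc X ≤ (∫⁻ x, f x ^ p ∂σ) ^ (1 / p) * (∫⁻ x, G x ^ q ∂σ) ^ (1 / q) :=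
          h1.trans (ENNReal.lintegral_mul_le_Lp_mul_Lq σ hpq hf hGm.aemeasurable)
      _ ≤ (∫⁻ x, f x ^ p ∂σ) ^ (1 / p) * (geomConst p ^ q * X) ^ (1 / q) := by
          gcongr
          exact one_div_nonneg.2 hpq.symm.nonneg
      _ = _ := by
          rw [ENNReal.mul_rpow_of_nonneg _ _ (one_div_nonneg.2 hpq.symm.nonneg),
            ← ENNReal.rpow_mul, mul_one_div_cancel hpq.symm.ne_zero, ENNReal.rpow_one]
          ring
  have hXs : X = X ^ (1 / p) * X ^ (1 / q) := by
    rw [← ENNReal.rpow_add _ _ hX0 hXt, one_div, one_div, hpq.inv_add_inv_eq_one, ENNReal.rpow_one]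
  have hXq0 : X ^ (1 / q) ≠ 0 := by simp [ENNReal.rpow_eq_zero_iff, hX0, hXt]
  have hXqt : X ^ (1 / q) ≠ ∞ :=
    ENNReal.rpow_ne_top_of_nonneg (one_div_nonneg.2 hpq.symm.nonneg) hXt
  have h4 : X ^ (1 / p) ≤ geomConst p * (∫⁻ x, f x ^ p ∂σ) ^ (1 / p) := by
    refine (ENNReal.mul_le_mul_iff_left hXq0 hXqt).1 ?_
    rw [← hXs]; exact h3
  have h5 := ENNReal.rpow_le_rpow h4 hp0.le
  rwa [ENNReal.mul_rpow_of_nonneg _ _ hp0.le, ← ENNReal.rpow_mul, ← ENNReal.rpow_mul,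
    one_div_mul_cancel hp0.ne', ENNReal.rpow_one, ENNReal.rpow_one] at h5

open Classical in
/-- The Carleson embedding theorem for a finite laminar family. -/
theorem sum_mul_average_rpow_le {p : ℝ} (hp : 1 < p) (σ : Measure α) (S : Finset (Set α))
    (hS : IsLaminar (S : Set (Set α))) (hm : ∀ A ∈ S, MeasurableSet A)
    (hσ : ∀ A ∈ S, σ A ≠ ∞) (f : α → ℝ≥0∞) (hf : AEMeasurable f σ)
    (hfin : ∀ A ∈ S, ∫⁻ x in A, f x ∂σ ≠ ∞) (a : Set α → ℝ≥0∞) (c : ℝ≥0∞)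
    (ha : ∀ R ∈ S, ∑ A ∈ S with A ⊆ R, a A ≤ c * σ R) :
    ∑ A ∈ S, a A * ((∫⁻ x in A, f x ∂σ) / σ A) ^ p ≤
      2 ^ p * c * geomConst p ^ p * ∫⁻ x, f x ^ p ∂σ := by
  have hp0 : 0 < p := by linarith
  set m : Set α → ℝ≥0∞ := fun A => (∫⁻ x in A, f x ∂σ) / σ A with hmdef
  change ∑ A ∈ S, a A * m A ^ p ≤ _
  obtain ⟨P, hPS, -, hdom, hdbl⟩ := exists_principal S m
  calc ∑ A ∈ S, a A * m A ^ p ≤ ∑ A ∈ S, ∑ R ∈ P with A ⊆ R, 2 ^ p * (a A * m R ^ p) := by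
        refine Finset.sum_le_sum fun A hA => ?_
        by_cases h0 : m A = 0
        · rw [h0, ENNReal.zero_rpow_of_pos hp0, mul_zero]; exact zero_le
        obtain ⟨R, hR, hAR, hle⟩ := hdom A hA h0
        calc a A * m A ^ p ≤ a A * (2 * m R) ^ p := by gcongr
          _ = 2 ^ p * (a A * m R ^ p) := by
              rw [ENNReal.mul_rpow_of_nonneg _ _ hp0.le]; ring
          _ ≤ _ := Finset.single_le_sum (f := fun R => 2 ^ p * (a A * m R ^ p))
              (fun _ _ => zero_le) (Finset.mem_filter.2 ⟨hR, hAR⟩)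
    _ = ∑ R ∈ P, ∑ A ∈ S with A ⊆ R, 2 ^ p * (a A * m R ^ p) := by
        simp only [Finset.sum_filter]
        exact Finset.sum_comm
    _ ≤ ∑ R ∈ P, 2 ^ p * c * (m R ^ p * σ R) := by
        refine Finset.sum_le_sum fun R hR => ?_
        rw [← Finset.mul_sum, ← Finset.sum_mul]
        calc 2 ^ p * ((∑ A ∈ S with A ⊆ R, a A) * m R ^ p)
            ≤ 2 ^ p * ((c * σ R) * m R ^ p) := by gcongr; exact ha R (hPS hR)
          _ = _ := by ring
    _ ≤ 2 ^ p * c * (geomConst p ^ p * ∫⁻ x, f x ^ p ∂σ) := by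
        rw [← Finset.mul_sum]
        gcongr
        exact sum_average_rpow_le_of_doubling hp σ P (hS.mono hPS) (fun A hA => hm A (hPS hA))
          (fun A hA => hσ A (hPS hA)) f hf (fun A hA => hfin A (hPS hA)) hdbl
    _ = _ := by ring

open Classical in
/-- The packing bound for coefficients such as `σ A / ρ_{σ,ε}(A)`, with `r = ρ_σ`. The family is
split into layers on which `r` is comparable to `2 ^ k`; a layer contributes at most `4 e k σ X`,
because below each of its members the packing constant is `2 r ≤ 4 · 2 ^ k`. -/
theorem sum_le_of_layers (σ : Measure α) (S : Finset (Set α))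
    (hS : IsLaminar (S : Set (Set α))) (hm : ∀ A ∈ S, MeasurableSet A)
    (r a : Set α → ℝ≥0∞) (e : ℕ → ℝ≥0∞)
    (hr : ∀ R ∈ S, r R ≠ ∞ → ∑ A ∈ S with A ⊆ R, σ A ≤ 2 * r R * σ R)
    (ha : ∀ A ∈ S, a A ≠ 0 → ∃ k : ℕ, r A ≤ 2 ^ (k + 1) ∧
      a A ≤ (2 ^ k)⁻¹ * e k * σ A) {X : Set α} :
    ∑ A ∈ S with A ⊆ X, a A ≤ 4 * (∑' k, e k) * σ X := by
  set L : ℕ → Finset (Set α) := fun k => S.filter fun A => A ⊆ X ∧ r A ≤ 2 ^ (k + 1) with hL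
  have hLS : ∀ k, ∀ A ∈ L k, A ∈ S := fun k A hA => (Finset.mem_filter.1 hA).1
  have hlayer : ∀ k, ∑ A ∈ L k, σ A ≤ 2 * 2 ^ (k + 1) * σ X := by
    intro k
    refine sum_le_of_packing σ (L k) (hS.mono fun A hA => hLS k A hA)
      (fun A hA => hm A (hLS k A hA)) X (fun A hA => (Finset.mem_filter.1 hA).2.1) σ _ fun R hR => ?_
    have hrR := (Finset.mem_filter.1 hR).2.2
    have hrt : r R ≠ ∞ := ne_top_of_le_ne_top (by finiteness) hrR
    calc ∑ A ∈ L k with A ⊆ R, σ A ≤ ∑ A ∈ S with A ⊆ R, σ A :=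
          Finset.sum_le_sum_of_subset (Finset.filter_subset_filter _ (Finset.filter_subset _ _))
      _ ≤ 2 * r R * σ R := hr R (hLS k R hR) hrt
      _ ≤ _ := by gcongr
  calc ∑ A ∈ S with A ⊆ X, a A
      ≤ ∑ A ∈ S with A ⊆ X, ∑' k, if A ∈ L k then (2 ^ k)⁻¹ * e k * σ A else 0 := by
        refine Finset.sum_le_sum fun A hA => ?_
        obtain ⟨hAS, hAX⟩ := Finset.mem_filter.1 hA
        by_cases h0 : a A = 0
        · rw [h0]; exact zero_le
        obtain ⟨k, hk, hak⟩ := ha A hAS h0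
        refine le_trans ?_ (ENNReal.le_tsum k)
        rw [if_pos (Finset.mem_filter.2 ⟨hAS, hAX, hk⟩)]
        exact hak
    _ = ∑' k, ∑ A ∈ S with A ⊆ X, if A ∈ L k then (2 ^ k)⁻¹ * e k * σ A else 0 :=
        (Summable.tsum_finsetSum fun _ _ => ENNReal.summable).symm
    _ ≤ ∑' k, 4 * e k * σ X := by
        refine ENNReal.tsum_le_tsum fun k => ?_
        calc ∑ A ∈ S with A ⊆ X, (if A ∈ L k then (2 ^ k)⁻¹ * e k * σ A else 0)
            ≤ ∑ A ∈ L k, (2 ^ k)⁻¹ * e k * σ A := by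
              rw [← Finset.sum_filter]
              exact Finset.sum_le_sum_of_subset fun A hA => (Finset.mem_filter.1 hA).2
          _ ≤ (2 ^ k)⁻¹ * e k * (2 * 2 ^ (k + 1) * σ X) := by
              rw [← Finset.mul_sum]; gcongr; exact hlayer k
          _ = ((2 ^ k)⁻¹ * 2 ^ k) * (4 * e k * σ X) := by ring
          _ = 4 * e k * σ X := by
              rw [ENNReal.inv_mul_cancel (by simp) (by finiteness), one_mul]
    _ = 4 * (∑' k, e k) * σ X := by rw [ENNReal.tsum_mul_right, ENNReal.tsum_mul_left]

end

/-! ### The two-weight bound for finite families -/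

section

variable {α : Type*} [MeasurableSpace α]

open Classical in
/-- The two-weight bound for the maximal function over a finite laminar family, with constants
independent of the family. The coefficients `a` stand for `σ A / ρ_{σ,ε}(A)`; the hypothesis `hpack`
is the packing of sparse subfamilies that the definition of `ρ_σ` provides. -/
theorem lintegral_iSup_average_rpow_le {p : ℝ} (hp : 1 < p) (μ σ w : Measure α)
    (F : Finset (Set α)) (hF : IsLaminar (F : Set (Set α))) (hm : ∀ A ∈ F, MeasurableSet A)
    (hμ0 : ∀ A ∈ F, μ A ≠ 0) (hμ : ∀ A ∈ F, μ A ≠ ∞) (hσ : ∀ A ∈ F, σ A ≠ ∞)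
    (f : α → ℝ≥0∞) (hf : AEMeasurable f σ) (hfin : ∀ A ∈ F, ∫⁻ x in A, f x ∂σ ≠ ∞)
    (r a : Set α → ℝ≥0∞) (e : ℕ → ℝ≥0∞) (K : ℝ≥0∞)
    (hpack : ∀ S ⊆ F, (∀ A ∈ S, μ A ≤ 2 * μ (exclusivePart S A)) →
      ∀ R ∈ S, r R ≠ ∞ → ∑ A ∈ S with A ⊆ R, σ A ≤ 2 * r R * σ R)
    (ha : ∀ A ∈ F, a A ≠ 0 → ∃ k : ℕ, r A ≤ 2 ^ (k + 1) ∧ a A ≤ (2 ^ k)⁻¹ * e k * σ A)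
    (hK : ∀ A ∈ F, (σ A / μ A) ^ p * w A ≤ K * a A) :
    ∫⁻ x, (⨆ A ∈ F, A.indicator (fun _ => (∫⁻ y in A, f y ∂σ) / μ A) x) ^ p ∂w ≤
      2 ^ p * (2 ^ p * (4 * ∑' k, e k) * geomConst p ^ p) * K * ∫⁻ x, f x ^ p ∂σ := by
  have hp0 : 0 < p := by linarith
  set v : Set α → ℝ≥0∞ := fun A => (∫⁻ y in A, f y ∂σ) / μ A with hv
  obtain ⟨S, hSF, hS0, hdom, hdbl⟩ := exists_principal F v
  have hνA : ∀ A ∈ F, (σ.withDensity f) A = ∫⁻ y in A, f y ∂σ := fun A hA =>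
    withDensity_apply _ (hm A hA)
  have hsparse : ∀ A ∈ S, μ A ≤ 2 * μ (exclusivePart S A) := by
    intro A hA
    refine measure_le_two_mul_exclusivePart μ (σ.withDensity f) S (hF.mono hSF)
      (fun B hB => hm B (hSF hB)) (fun B hB => hμ0 B (hSF hB)) (fun B hB => hμ B (hSF hB))
      (fun B hB => by rw [hνA B (hSF hB)]; exact hfin B (hSF hB))
      (fun B hB => by rw [hνA B (hSF hB)]; exact hS0 B hB) ?_ hA
    intro B hB D hD hDB
    rw [hνA B (hSF hB), hνA D (hSF hD)]
    exact hdbl B hB D hD hDB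
  have hcarleson : ∀ R ∈ S, ∑ A ∈ S with A ⊆ R, a A ≤ 4 * (∑' k, e k) * σ R := fun R _ =>
    sum_le_of_layers σ S (hF.mono hSF) (fun B hB => hm B (hSF hB)) r a e
      (fun R hR => hpack S hSF hsparse R hR) (fun A hA => ha A (hSF hA))
  have hterm : ∀ A ∈ F, v A ^ p * w A ≤ K * (a A * ((∫⁻ x in A, f x ∂σ) / σ A) ^ p) := by
    intro A hA
    have hvA : v A = (∫⁻ x in A, f x ∂σ) / σ A * (σ A / μ A) := by
      by_cases h0 : σ A = 0
      · simp [hv, h0, Measure.restrict_eq_zero.2 h0]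
      · rw [hv, ← mul_div_assoc, ENNReal.div_mul_cancel h0 (hσ A hA)]
    rw [hvA, ENNReal.mul_rpow_of_nonneg _ _ hp0.le]
    calc ((∫⁻ x in A, f x ∂σ) / σ A) ^ p * (σ A / μ A) ^ p * w A
        = ((∫⁻ x in A, f x ∂σ) / σ A) ^ p * ((σ A / μ A) ^ p * w A) := by ring
      _ ≤ ((∫⁻ x in A, f x ∂σ) / σ A) ^ p * (K * a A) := mul_le_mul_right (hK A hA) _
      _ = _ := by ring
  have hpt : ∀ x, (⨆ A ∈ F, A.indicator (fun _ => v A) x) ^ p ≤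
      ∑ A ∈ S, A.indicator (fun _ => 2 ^ p * v A ^ p) x := by
    intro x
    rw [← ENNReal.le_rpow_inv_iff hp0]
    refine iSup₂_le fun A hA => ?_
    rw [ENNReal.le_rpow_inv_iff hp0]
    by_cases hx : x ∈ A
    · rw [indicator_of_mem hx]
      by_cases h0 : v A = 0
      · rw [h0, ENNReal.zero_rpow_of_pos hp0]; exact zero_le
      obtain ⟨R, hR, hAR, hle⟩ := hdom A hA h0
      calc v A ^ p ≤ (2 * v R) ^ p := by gcongr
        _ = R.indicator (fun _ => 2 ^ p * v R ^ p) x := by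
            rw [indicator_of_mem (hAR hx), ENNReal.mul_rpow_of_nonneg _ _ hp0.le]
        _ ≤ _ := Finset.single_le_sum
            (f := fun R : Set α => R.indicator (fun _ => 2 ^ p * v R ^ p) x)
            (fun _ _ => zero_le) hR
    · rw [indicator_of_notMem hx, ENNReal.zero_rpow_of_pos hp0]; exact zero_le
  calc ∫⁻ x, (⨆ A ∈ F, A.indicator (fun _ => v A) x) ^ p ∂w
      ≤ ∫⁻ x, ∑ A ∈ S, A.indicator (fun _ => 2 ^ p * v A ^ p) x ∂w := lintegral_mono hpt
    _ = ∑ A ∈ S, 2 ^ p * v A ^ p * w A := by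
        rw [lintegral_finsetSum _ fun A hA => measurable_const.indicator (hm A (hSF hA))]
        exact Finset.sum_congr rfl fun A hA => lintegral_indicator_const (hm A (hSF hA)) _
    _ ≤ ∑ A ∈ S, 2 ^ p * (K * (a A * ((∫⁻ x in A, f x ∂σ) / σ A) ^ p)) := by
        refine Finset.sum_le_sum fun A hA => ?_
        rw [mul_assoc]
        exact mul_le_mul_right (hterm A (hSF hA)) _
    _ = 2 ^ p * (K * ∑ A ∈ S, a A * ((∫⁻ x in A, f x ∂σ) / σ A) ^ p) := by
        rw [Finset.mul_sum, Finset.mul_sum]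
    _ ≤ 2 ^ p * (K * (2 ^ p * (4 * ∑' k, e k) * geomConst p ^ p * ∫⁻ x, f x ^ p ∂σ)) := by
        gcongr
        exact sum_mul_average_rpow_le hp σ S (hF.mono hSF) (fun A hA => hm A (hSF hA))
          (fun A hA => hσ A (hSF hA)) f hf (fun A hA => hfin A (hSF hA)) a _ hcarleson
    _ = _ := by ring

end

/-! ### The entropy series -/

/-- Condensation: the entropy integral controls the dyadic series `∑ 1 / ε(2^k)`. -/
theorem tsum_inv_le_of_lintegral_eq_one {ε : ℝ → ℝ} {ε₀ : ℝ} (hε₀ : 0 < ε₀)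
    (hmono : MonotoneOn ε (Ici 1)) (hε1 : ε₀ ≤ ε 1)
    (hint : ∫⁻ t in Ioi (1 : ℝ), ENNReal.ofReal (1 / (ε t * t)) = 1) :
    ∑' k : ℕ, (ENNReal.ofReal (ε (2 ^ k)))⁻¹ ≤ (ENNReal.ofReal ε₀)⁻¹ + 2 := by
  have hone : ∀ k : ℕ, (1 : ℝ) ≤ 2 ^ k := fun k => one_le_pow₀ (by norm_num)
  have hpos : ∀ t, 1 ≤ t → 0 < ε t := fun t ht =>
    hε₀.trans_le (hε1.trans (hmono self_mem_Ici ht ht))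
  have hpiece : ∀ k : ℕ, (ENNReal.ofReal (ε (2 ^ (k + 1))))⁻¹ ≤
      2 * ∫⁻ t in Ioc ((2 : ℝ) ^ k) (2 ^ (k + 1)), ENNReal.ofReal (1 / (ε t * t)) := by
    intro k
    set b : ℝ := 2 ^ (k + 1) with hb
    have hb0 : 0 < b := by positivity
    have hεb := hpos b (hone _)
    have hle : ∫⁻ t in Ioc ((2 : ℝ) ^ k) b, ENNReal.ofReal (1 / (ε b * b)) ≤
        ∫⁻ t in Ioc ((2 : ℝ) ^ k) b, ENNReal.ofReal (1 / (ε t * t)) := by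
      refine setLIntegral_mono' measurableSet_Ioc fun t ht => ENNReal.ofReal_le_ofReal ?_
      have ht1 : 1 ≤ t := (hone k).trans ht.1.le
      have ht0 : 0 < t := by linarith
      have hεt := hpos t ht1
      have hεle : ε t ≤ ε b := hmono ht1 (hone _) ht.2
      exact one_div_le_one_div_of_le (by positivity) (mul_le_mul hεle ht.2 ht0.le hεb.le)
    refine le_trans (le_of_eq ?_) (mul_le_mul_right hle 2)
    rw [setLIntegral_const, Real.volume_Ioc, ← ENNReal.ofReal_inv_of_pos hεb,
      ← ENNReal.ofReal_mul (by positivity), ← ENNReal.ofReal_ofNat 2,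
      ← ENNReal.ofReal_mul (by norm_num)]
    congr 1
    have : (2 : ℝ) ^ k = b / 2 := by rw [hb, pow_succ]; ring
    rw [this]
    field_simp
    ring
  have hsum : ∑' k : ℕ, ∫⁻ t in Ioc ((2 : ℝ) ^ k) (2 ^ (k + 1)), ENNReal.ofReal (1 / (ε t * t)) ≤
      1 := by
    have hd := (show Monotone fun k : ℕ => (2 : ℝ) ^ k from
      fun i j h => pow_le_pow_right₀ (by norm_num) h).pairwise_disjoint_on_Ioc_succ
    simp only [Nat.succ_eq_succ, Nat.succ_eq_add_one] at hd
    rw [← lintegral_iUnion (fun _ => measurableSet_Ioc) hd, ← hint]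
    refine lintegral_mono_set (iUnion_subset fun k t ht => ?_)
    exact (hone k).trans_lt ht.1
  rw [tsum_eq_zero_add' ENNReal.summable]
  gcongr
  · rw [pow_zero]; exact hε1
  · calc ∑' k : ℕ, (ENNReal.ofReal (ε (2 ^ (k + 1))))⁻¹
        ≤ ∑' k : ℕ, 2 * ∫⁻ t in Ioc ((2 : ℝ) ^ k) (2 ^ (k + 1)), ENNReal.ofReal (1 / (ε t * t)) :=
          ENNReal.tsum_le_tsum hpiece
      _ ≤ 2 * 1 := by rw [ENNReal.tsum_mul_left]; gcongr
      _ = 2 := mul_one 2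

/-! ### Cubes, averages and `ρ_σ` -/

section Cubes

variable {d : ℕ}

/-- The half-open version `∏ i, [a i, a i + ℓ)` of a cube. Half-open dyadic cubes are laminar. -/
def Cube.half (Q : Cube d) : Set (Fin d → ℝ) :=
  univ.pi fun i => Ico (Q.corner i) (Q.corner i + Q.side)

theorem Cube.measurableSet_half (Q : Cube d) : MeasurableSet Q.half :=
  MeasurableSet.univ_pi fun _ => measurableSet_Ico

theorem Cube.measurableSet_toSet (Q : Cube d) : MeasurableSet Q.toSet := measurableSet_Icc

theorem Cube.half_ae_eq (Q : Cube d) : Q.half =ᵐ[volume] Q.toSet :=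
  Measure.univ_pi_Ico_ae_eq_Icc

theorem Cube.half_subset (Q : Cube d) : Q.half ⊆ Q.toSet := by
  intro x hx
  exact ⟨fun i => (hx i trivial).1, fun i => (hx i trivial).2.le⟩

theorem Cube.volume_toSet (Q : Cube d) : volume Q.toSet = ENNReal.ofReal Q.side ^ d := by
  simp [Cube.toSet, Real.volume_Icc_pi]

theorem Cube.volume_half (Q : Cube d) : volume Q.half = ENNReal.ofReal Q.side ^ d := by
  rw [measure_congr Q.half_ae_eq, Q.volume_toSet]

theorem Cube.volume_half_ne_zero (Q : Cube d) : volume Q.half ≠ 0 := by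
  rw [Q.volume_half]
  exact pow_ne_zero _ (ENNReal.ofReal_pos.2 Q.side_pos).ne'

theorem Cube.volume_half_ne_top (Q : Cube d) : volume Q.half ≠ ∞ := by
  rw [Q.volume_half]
  exact ENNReal.pow_ne_top ENNReal.ofReal_ne_top

theorem weightMeasure_half (σ : (Fin d → ℝ) → ℝ) (Q : Cube d) :
    weightMeasure σ Q.half = weightMeasure σ Q.toSet :=
  measure_congr ((withDensity_absolutelyContinuous _ _).ae_eq Q.half_ae_eq)

theorem cubeAverage_eq_half (g : (Fin d → ℝ) → ℝ) (Q : Cube d) :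
    cubeAverage g Q = (∫⁻ x in Q.half, ‖g x‖ₑ) / volume Q.half := by
  rw [cubeAverage, setLAverage_eq, measure_congr Q.half_ae_eq, setLIntegral_congr Q.half_ae_eq]

theorem IsWeight.lintegral_half {σ : (Fin d → ℝ) → ℝ} (hσ : IsWeight σ) (Q : Cube d) :
    ∫⁻ x in Q.half, ‖σ x‖ₑ = weightMeasure σ Q.half := by
  rw [weightMeasure, withDensity_apply _ Q.measurableSet_half]
  exact lintegral_congr fun x => Real.enorm_of_nonneg (hσ.nonneg x)

theorem IsWeight.cubeAverage_eq {σ : (Fin d → ℝ) → ℝ} (hσ : IsWeight σ) (Q : Cube d) :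
    cubeAverage σ Q = weightMeasure σ Q.half / volume Q.half := by
  rw [cubeAverage_eq_half, hσ.lintegral_half]

theorem IsWeight.weightMeasure_half_ne_top {σ : (Fin d → ℝ) → ℝ} (hσ : IsWeight σ) (Q : Cube d) :
    weightMeasure σ Q.half ≠ ∞ := by
  rw [← hσ.lintegral_half]
  have hint : IntegrableOn σ Q.toSet volume :=
    hσ.locallyIntegrable.integrableOn_isCompact isCompact_Icc
  exact (hint.mono_set Q.half_subset).hasFiniteIntegral.ne

/-- Averages of `σ f` against Lebesgue measure are integrals of `f` against `σ dx`. -/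
theorem IsWeight.cubeAverage_mul {σ : (Fin d → ℝ) → ℝ} (hσ : IsWeight σ) {f : (Fin d → ℝ) → ℝ}
    (hf : AEMeasurable (fun x => ‖f x‖ₑ) (weightMeasure σ)) (Q : Cube d) :
    cubeAverage (fun x => σ x * f x) Q =
      (∫⁻ x in Q.half, ‖f x‖ₑ ∂(weightMeasure σ)) / volume Q.half := by
  rw [cubeAverage_eq_half]
  congr 1
  have hσm : AEMeasurable (fun x => ENNReal.ofReal (σ x)) (volume.restrict Q.half) :=
    hσ.locallyIntegrable.aestronglyMeasurable.aemeasurable.ennreal_ofReal.restrict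
  rw [weightMeasure, restrict_withDensity Q.measurableSet_half,
    lintegral_withDensity_eq_lintegral_mul₀' hσm]
  · refine lintegral_congr fun x => ?_
    rw [Pi.mul_apply, enorm_mul, Real.enorm_of_nonneg (hσ.nonneg x)]
  · rw [← restrict_withDensity Q.measurableSet_half]
    exact hf.restrict

/-- `ρ_σ(Q) ≥ 1`, since `M(σ 1_Q) ≥ ⟨σ⟩_Q` on `Q`. -/
theorem IsWeight.one_le_rho {σ : (Fin d → ℝ) → ℝ} (hσ : IsWeight σ) (Q : Cube d)
    (h0 : weightMeasure σ Q.toSet ≠ 0) : 1 ≤ rho σ Q := by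
  have ht : weightMeasure σ Q.toSet ≠ ∞ := by
    rw [← weightMeasure_half]; exact hσ.weightMeasure_half_ne_top Q
  rw [rho, ENNReal.le_div_iff_mul_le (Or.inl h0) (Or.inl ht), one_mul]
  have hav : cubeAverage (Q.toSet.indicator σ) Q = weightMeasure σ Q.toSet / volume Q.toSet := by
    rw [← weightMeasure_half, ← measure_congr Q.half_ae_eq, cubeAverage_eq_half,
      ← hσ.lintegral_half]
    congr 1
    refine setLIntegral_congr_fun Q.measurableSet_half fun x hx => ?_
    simp only [indicator_of_mem (Q.half_subset hx)]
  have hv0 : volume Q.toSet ≠ 0 := by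
    rw [← measure_congr Q.half_ae_eq]; exact Q.volume_half_ne_zero
  have hvt : volume Q.toSet ≠ ∞ := by
    rw [← measure_congr Q.half_ae_eq]; exact Q.volume_half_ne_top
  calc weightMeasure σ Q.toSet
      = ∫⁻ _ in Q.toSet, cubeAverage (Q.toSet.indicator σ) Q := by
        rw [setLIntegral_const, hav, ENNReal.div_mul_cancel hv0 hvt]
    _ ≤ _ := setLIntegral_mono' Q.measurableSet_toSet fun x hx =>
        le_iSup₂ (f := fun (Q' : Cube d) (_ : x ∈ Q'.toSet) =>
          cubeAverage (Q.toSet.indicator σ) Q') Q hx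

open Classical in
/-- Packing of a sparse family of cubes: on the exclusive parts, which are disjoint and carry half
of the Lebesgue measure, `M(σ 1_R)` is at least the corresponding average of `σ`. -/
theorem IsWeight.sum_le_rho_mul {σ : (Fin d → ℝ) → ℝ} (hσ : IsWeight σ)
    (S : Finset (Set (Fin d → ℝ))) (hS : IsLaminar (S : Set (Set (Fin d → ℝ))))
    (Q : Set (Fin d → ℝ) → Cube d) (hQ : ∀ A ∈ S, (Q A).half = A)
    (hsparse : ∀ A ∈ S, volume A ≤ 2 * volume (exclusivePart S A)) {R : Set (Fin d → ℝ)}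
    (hR : R ∈ S) :
    ∑ A ∈ S with A ⊆ R, weightMeasure σ A ≤ 2 * rho σ (Q R) * weightMeasure σ R := by
  have hm : ∀ A ∈ S, MeasurableSet A := fun A hA => by
    rw [← hQ A hA]; exact (Q A).measurableSet_half
  by_cases h0 : weightMeasure σ R = 0
  · have : ∑ A ∈ S with A ⊆ R, weightMeasure σ A = 0 :=
      Finset.sum_eq_zero fun A hA => measure_mono_null (Finset.mem_filter.1 hA).2 h0
    rw [this]; exact zero_le
  set N : (Fin d → ℝ) → ℝ≥0∞ := maximalFunction ((Q R).toSet.indicator σ) with hN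
  have hRsub : R ⊆ (Q R).toSet := by
    conv_lhs => rw [← hQ R hR]
    exact (Q R).half_subset
  have hRσ : weightMeasure σ (Q R).toSet = weightMeasure σ R := by
    rw [← weightMeasure_half, hQ R hR]
  have hRt : weightMeasure σ R ≠ ∞ := by
    rw [← hQ R hR]; exact hσ.weightMeasure_half_ne_top _
  have hterm : ∀ A ∈ S, A ⊆ R →
      weightMeasure σ A ≤ 2 * ∫⁻ x in exclusivePart S A, N x := by
    intro A hA hAR
    have hv0 : volume A ≠ 0 := by rw [← hQ A hA]; exact (Q A).volume_half_ne_zero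
    have hvt : volume A ≠ ∞ := by rw [← hQ A hA]; exact (Q A).volume_half_ne_top
    have hav : cubeAverage ((Q R).toSet.indicator σ) (Q A) = weightMeasure σ A / volume A := by
      rw [cubeAverage_eq_half, hQ A hA]
      congr 1
      have := hσ.lintegral_half (Q A)
      rw [hQ A hA] at this
      rw [← this]
      refine setLIntegral_congr_fun (hm A hA) fun x hx => ?_
      simp only [indicator_of_mem (hRsub (hAR hx))]
    calc weightMeasure σ A = weightMeasure σ A / volume A * volume A :=
          (ENNReal.div_mul_cancel hv0 hvt).symm
      _ ≤ weightMeasure σ A / volume A * (2 * volume (exclusivePart S A)) := by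
          gcongr; exact hsparse A hA
      _ = 2 * ∫⁻ _ in exclusivePart S A, cubeAverage ((Q R).toSet.indicator σ) (Q A) := by
          rw [setLIntegral_const, hav]; ring
      _ ≤ 2 * ∫⁻ x in exclusivePart S A, N x := by
          refine mul_le_mul_right (setLIntegral_mono' (measurableSet_exclusivePart hm hA)
            fun x hx => ?_) 2
          have hx' : x ∈ (Q A).toSet := by
            refine (Q A).half_subset ?_
            rw [hQ A hA]; exact exclusivePart_subset S A hx
          exact le_iSup₂ (f := fun (Q' : Cube d) (_ : x ∈ Q'.toSet) =>
            cubeAverage ((Q R).toSet.indicator σ) Q') (Q A) hx'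
  calc ∑ A ∈ S with A ⊆ R, weightMeasure σ A
      ≤ ∑ A ∈ S with A ⊆ R, 2 * ∫⁻ x in exclusivePart S A, N x :=
        Finset.sum_le_sum fun A hA =>
          hterm A (Finset.mem_filter.1 hA).1 (Finset.mem_filter.1 hA).2
    _ = 2 * ∫⁻ x in ⋃ A ∈ S.filter (· ⊆ R), exclusivePart S A, N x := by
        rw [← Finset.mul_sum, lintegral_biUnion_finset]
        · exact (pairwiseDisjoint_exclusivePart S hS).subset fun A hA => (Finset.mem_filter.1 hA).1
        · exact fun A hA => measurableSet_exclusivePart hm (Finset.mem_filter.1 hA).1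
    _ ≤ 2 * ∫⁻ x in (Q R).toSet, N x := by
        refine mul_le_mul_right (lintegral_mono_set (iUnion₂_subset fun A hA => ?_)) 2
        exact (exclusivePart_subset S A).trans ((Finset.mem_filter.1 hA).2.trans hRsub)
    _ = 2 * rho σ (Q R) * weightMeasure σ R := by
        rw [rho, hRσ, mul_assoc, ENNReal.div_mul_cancel h0 hRt]

end Cubes

/-! ### Shifted dyadic grids -/

section Grids

variable {d : ℕ}

/-- The shift at level `k`, in units of the side length `2⁻ᵏ`, of a coordinate of a shifted dyadic
grid (`b = true`): alternately `1/3` and `2/3`. Since `2 · 2/3 ≡ 1/3` modulo `1`, the levels are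
nested. -/
noncomputable def gridShift (b : Bool) (k : ℤ) : ℝ :=
  if b then (if Even k then 1 / 3 else 2 / 3) else 0

theorem floor_gridShift_eq_of_succ (b : Bool) (k : ℤ) {s t : ℝ}
    (h : ⌊2 ^ (k + 1) * s + gridShift b (k + 1)⌋ = ⌊2 ^ (k + 1) * t + gridShift b (k + 1)⌋) :
    ⌊2 ^ k * s + gridShift b k⌋ = ⌊2 ^ k * t + gridShift b k⌋ := by
  obtain ⟨n, hn⟩ : ∃ n : ℤ, 2 * gridShift b k = gridShift b (k + 1) + n := by
    rcases b with _ | _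
    · exact ⟨0, by simp [gridShift]⟩
    · by_cases hk : Even k
      · have hk' : ¬ Even (k + 1) := by rwa [Int.even_add_one, not_not]
        refine ⟨0, ?_⟩
        simp only [gridShift, if_true, if_pos hk, if_neg hk']
        norm_num
      · have hk' : Even (k + 1) := by rwa [Int.even_add_one]
        refine ⟨1, ?_⟩
        simp only [gridShift, if_true, if_neg hk, if_pos hk']
        norm_num
  have key : ∀ y : ℝ, ⌊2 ^ k * y + gridShift b k⌋ =
      (⌊2 ^ (k + 1) * y + gridShift b (k + 1)⌋ + n) / (2 : ℕ) := by
    intro y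
    rw [← Int.floor_add_intCast, ← Int.floor_div_natCast]
    congr 1
    rw [zpow_add_one₀ (by norm_num)]
    push_cast
    linarith
  rw [key, key, h]

theorem floor_gridShift_eq_of_le (b : Bool) {k l : ℤ} (hkl : k ≤ l) {s t : ℝ}
    (h : ⌊2 ^ l * s + gridShift b l⌋ = ⌊2 ^ l * t + gridShift b l⌋) :
    ⌊2 ^ k * s + gridShift b k⌋ = ⌊2 ^ k * t + gridShift b k⌋ := by
  obtain ⟨n, rfl⟩ := Int.le.dest hkl
  induction n with
  | zero => simpa using h
  | succ n ih =>
    refine ih (by omega) (floor_gridShift_eq_of_succ b _ ?_)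
    rw [show k + (n : ℤ) + 1 = k + ((n + 1 : ℕ) : ℤ) by push_cast; ring]
    exact h

/-- The cube of side `2⁻ᵏ` and position `m` in the dyadic grid shifted in the coordinates `i` with
`u i = true`. -/
noncomputable def dyadicCube (u : Fin d → Bool) (k : ℤ) (m : Fin d → ℤ) : Cube d where
  corner i := (m i - gridShift (u i) k) / 2 ^ k
  side := 1 / 2 ^ k
  side_pos := by positivity

theorem mem_half_dyadicCube {u : Fin d → Bool} {k : ℤ} {m : Fin d → ℤ} {x : Fin d → ℝ} :
    x ∈ (dyadicCube u k m).half ↔ ∀ i, ⌊2 ^ k * x i + gridShift (u i) k⌋ = m i := by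
  have h2 : (0 : ℝ) < 2 ^ k := by positivity
  simp only [Cube.half, dyadicCube, mem_univ_pi, mem_Ico, Int.floor_eq_iff, ← add_div,
    div_le_iff₀ h2, lt_div_iff₀ h2]
  refine forall_congr' fun i => and_congr ?_ ?_ <;> constructor <;> intro h <;> linarith

/-- The half-open cubes of the dyadic grid with shift pattern `u`. -/
def dyadicGrid (u : Fin d → Bool) : Set (Set (Fin d → ℝ)) :=
  range fun n : ℤ × (Fin d → ℤ) => (dyadicCube u n.1 n.2).half

theorem isLaminar_dyadicGrid (u : Fin d → Bool) : IsLaminar (dyadicGrid u) := by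
  have key : ∀ (k l : ℤ) (m n : Fin d → ℤ), k ≤ l → ∀ x, x ∈ (dyadicCube u k m).half →
      x ∈ (dyadicCube u l n).half → (dyadicCube u l n).half ⊆ (dyadicCube u k m).half := by
    intro k l m n hkl x hx hx' y hy
    rw [mem_half_dyadicCube] at *
    intro i
    rw [← hx i]
    exact floor_gridShift_eq_of_le (u i) hkl ((hy i).trans (hx' i).symm)
  rintro _ ⟨⟨k, m⟩, rfl⟩ _ ⟨⟨l, n⟩, rfl⟩
  by_cases hd : Disjoint (dyadicCube u k m).half (dyadicCube u l n).half
  · exact Or.inr (Or.inr hd)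
  obtain ⟨x, hx, hx'⟩ := Set.not_disjoint_iff.1 hd
  rcases le_total k l with h | h
  · exact Or.inr (Or.inl (key k l m n h x hx hx'))
  · exact Or.inl (key l k n m h x hx' hx)

/-- The one-third trick: a short interval avoids the integers or their shifts by `1/3` or `2/3`. -/
theorem exists_floor_gridShift_eq (k : ℤ) {y h : ℝ} (hh : h ≤ 1 / 3) :
    ∃ b : Bool, ⌊y + h + gridShift b k⌋ ≤ ⌊y + gridShift b k⌋ := by
  by_contra hcon
  push Not at hcon
  have h1 := Int.add_one_le_iff.2 (hcon false)
  have h2 := Int.add_one_le_iff.2 (hcon true)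
  rw [Int.le_floor] at h1 h2
  have h3 := Int.lt_floor_add_one (y + gridShift false k)
  have h4 := Int.lt_floor_add_one (y + gridShift true k)
  set n := ⌊y + gridShift false k⌋
  set m := ⌊y + gridShift true k⌋
  push_cast at h1 h2
  simp only [gridShift, Bool.false_eq_true, if_false, if_true, add_zero] at h1 h2 h3 h4
  by_cases hk : Even k
  · simp only [hk, if_true] at h2 h4
    have ha : (m : ℝ) < n + 1 := by linarith
    have hb : (n : ℝ) - 1 < m := by linarith
    have ha' : m < n + 1 := by exact_mod_cast ha
    have hb' : n - 1 < m := by exact_mod_cast hb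
    have : m = n := by omega
    rw [this] at h2 h4
    linarith
  · simp only [hk, if_false] at h2 h4
    have ha : (m : ℝ) < n + 2 := by linarith
    have hb : (n : ℝ) < m := by linarith
    have ha' : m < n + 2 := by exact_mod_cast ha
    have hb' : n < m := by exact_mod_cast hb
    have : m = n + 1 := by omega
    rw [this] at h2 h4
    push_cast at h2 h4
    linarith

/-- Every cube lies in a cube of comparable size from one of the shifted grids. -/
theorem Cube.exists_subset_dyadicCube (Q : Cube d) :
    ∃ (u : Fin d → Bool) (k : ℤ) (m : Fin d → ℤ), Q.toSet ⊆ (dyadicCube u k m).half ∧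
      (dyadicCube u k m).side ≤ 6 * Q.side := by
  have hs := Q.side_pos
  obtain ⟨k, hk1, hk2⟩ := exists_mem_Ico_zpow (x := 1 / (3 * Q.side)) (y := (2 : ℝ))
    (by positivity) (by norm_num)
  have h2 : (0 : ℝ) < 2 ^ k := by positivity
  have hk1' : 2 ^ k * Q.side ≤ 1 / 3 := by
    rw [le_div_iff₀ (by positivity)] at hk1
    linarith
  choose u hu using fun i => exists_floor_gridShift_eq k (y := 2 ^ k * Q.corner i) hk1'
  refine ⟨u, k, fun i => ⌊2 ^ k * Q.corner i + gridShift (u i) k⌋, fun x hx => ?_, ?_⟩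
  · rw [mem_half_dyadicCube]
    intro i
    have hx1 : 2 ^ k * Q.corner i ≤ 2 ^ k * x i := by gcongr; exact hx.1 i
    have hx2 : 2 ^ k * x i ≤ 2 ^ k * (Q.corner i + Q.side) := by gcongr; exact hx.2 i
    refine le_antisymm ((Int.floor_le_floor ?_).trans (hu i)) (Int.floor_le_floor ?_) <;> linarith
  · change 1 / 2 ^ k ≤ 6 * Q.side
    rw [zpow_add_one₀ (by norm_num), div_lt_iff₀ (by positivity)] at hk2
    rw [div_le_iff₀ h2]
    linarith

/-- The maximal function is dominated by the maximal functions of the shifted dyadic grids. -/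
theorem maximalFunction_le (g : (Fin d → ℝ) → ℝ) (x : Fin d → ℝ) :
    maximalFunction g x ≤ 6 ^ d * ⨆ (u : Fin d → Bool), ⨆ n : ℤ × (Fin d → ℤ),
      (dyadicCube u n.1 n.2).half.indicator
        (fun _ => cubeAverage g (dyadicCube u n.1 n.2)) x := by
  refine iSup₂_le fun Q hx => ?_
  obtain ⟨u, k, m, hsub, hside⟩ := Q.exists_subset_dyadicCube
  refine le_trans ?_ (mul_le_mul_right (le_iSup_of_le (f := fun u : Fin d → Bool =>
    ⨆ n : ℤ × (Fin d → ℤ), (dyadicCube u n.1 n.2).half.indicator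
      (fun _ => cubeAverage g (dyadicCube u n.1 n.2)) x) u (le_iSup_of_le (k, m) le_rfl)) _)
  rw [indicator_of_mem (hsub hx), cubeAverage_eq_half g (dyadicCube u k m), cubeAverage,
    setLAverage_eq, ← mul_div_assoc]
  set P := dyadicCube u k m
  have hv : volume P.half ≤ 6 ^ d * volume Q.toSet := by
    rw [P.volume_half, Q.volume_toSet, ← mul_pow, ← ENNReal.ofReal_ofNat 6,
      ← ENNReal.ofReal_mul (by norm_num)]
    gcongr
  have hQ0 : volume Q.toSet ≠ 0 := by
    rw [← measure_congr Q.half_ae_eq]; exact Q.volume_half_ne_zero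
  have hQt : volume Q.toSet ≠ ∞ := by
    rw [← measure_congr Q.half_ae_eq]; exact Q.volume_half_ne_top
  rw [ENNReal.div_le_iff hQ0 hQt]
  calc ∫⁻ x in Q.toSet, ‖g x‖ₑ ≤ ∫⁻ x in P.half, ‖g x‖ₑ := lintegral_mono_set hsub
    _ = (∫⁻ x in P.half, ‖g x‖ₑ) / volume P.half * volume P.half :=
        (ENNReal.div_mul_cancel P.volume_half_ne_zero P.volume_half_ne_top).symm
    _ ≤ (∫⁻ x in P.half, ‖g x‖ₑ) / volume P.half * (6 ^ d * volume Q.toSet) := by gcongr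
    _ = 6 ^ d * (∫⁻ x in P.half, ‖g x‖ₑ) / volume P.half * volume Q.toSet := by
        rw [mul_div_assoc]; ring

end Grids

/-! ### The two-weight bound for dyadic and full maximal functions -/

section

variable {d : ℕ}

theorem ofReal_le_ofReal_of_monotoneOn {ε : ℝ → ℝ} (hmono : MonotoneOn ε (Ici 1)) {s t : ℝ}
    (hs : 1 ≤ s) (hst : s ≤ t) : ENNReal.ofReal (ε s) ≤ ENNReal.ofReal (ε t) :=
  ENNReal.ofReal_le_ofReal (hmono hs (hs.trans hst) hst)

/-- On a cube with `ρ_σ(Q) ∈ [2^k, 2^(k+1))`, the coefficient `σ(Q) / ρ_{σ,ε}(Q)` is at most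
`2⁻ᵏ σ(Q) / ε(2^k)`. -/
theorem IsWeight.exists_layer {σ : (Fin d → ℝ) → ℝ} (hσ : IsWeight σ) {ε : ℝ → ℝ}
    (hmono : MonotoneOn ε (Ici 1)) (Q : Cube d)
    (hne : weightMeasure σ Q.half / rhoEps σ ε Q ≠ 0) :
    ∃ k : ℕ, rho σ Q ≤ 2 ^ (k + 1) ∧ weightMeasure σ Q.half / rhoEps σ ε Q ≤
      (2 ^ k)⁻¹ * (ENNReal.ofReal (ε (2 ^ k)))⁻¹ * weightMeasure σ Q.half := by
  rw [ENNReal.div_ne_zero] at hne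
  have hrt : rho σ Q ≠ ∞ := by
    intro h
    exact hne.2 (by simp [rhoEps, h])
  have hr1 : 1 ≤ rho σ Q := hσ.one_le_rho Q (by rw [← weightMeasure_half]; exact hne.1)
  set t := (rho σ Q).toReal with ht
  have hrt' : rho σ Q = ENNReal.ofReal t := (ENNReal.ofReal_toReal hrt).symm
  have ht1 : 1 ≤ t := by
    rw [hrt', ← ENNReal.ofReal_one] at hr1
    exact (ENNReal.ofReal_le_ofReal_iff ENNReal.toReal_nonneg).1 hr1
  obtain ⟨k, hk1, hk2⟩ := exists_nat_pow_near ht1 (by norm_num : (1 : ℝ) < 2)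
  have hpow : ∀ n : ℕ, ENNReal.ofReal ((2 : ℝ) ^ n) = 2 ^ n := fun n => by
    rw [ENNReal.ofReal_pow (by norm_num), ENNReal.ofReal_ofNat]
  refine ⟨k, ?_, ?_⟩
  · rw [hrt', ← hpow]
    exact ENNReal.ofReal_le_ofReal hk2.le
  · have hle : 2 ^ k * ENNReal.ofReal (ε (2 ^ k)) ≤ rhoEps σ ε Q := by
      rw [rhoEps, if_neg hrt, ← ht, hrt', ← hpow]
      exact mul_le_mul' (ENNReal.ofReal_le_ofReal hk1)
        (ofReal_le_ofReal_of_monotoneOn hmono (one_le_pow₀ (by norm_num)) hk1)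
    rw [← ENNReal.mul_inv (Or.inl (by simp)) (Or.inl (by finiteness)), ENNReal.div_eq_inv_mul]
    gcongr

/-- The bump condition on one cube, solved for `⟨σ⟩_Q^p w(Q)`. -/
theorem IsWeight.average_rpow_mul_le {σ w : (Fin d → ℝ) → ℝ} (hσ : IsWeight σ) (hw : IsWeight w)
    {p : ℝ} (hp : 1 < p) {ε : ℝ → ℝ} {ε₀ : ℝ} (hε₀ : 0 < ε₀) (hmono : MonotoneOn ε (Ici 1))
    (hε1 : ε₀ ≤ ε 1) (hK : entropyBump σ w p ε ≠ ∞) (Q : Cube d) :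
    (weightMeasure σ Q.half / volume Q.half) ^ p * weightMeasure w Q.half ≤
      entropyBump σ w p ε * (weightMeasure σ Q.half / rhoEps σ ε Q) := by
  have hp0 : 0 < p := by linarith
  have hp1 : 0 < p - 1 := by linarith
  by_cases hσ0 : weightMeasure σ Q.half = 0
  · simp [hσ0, hp0]
  by_cases hw0 : weightMeasure w Q.half = 0
  · simp [hw0]
  set s := weightMeasure σ Q.half with hs
  set v := volume Q.half with hv
  set b := weightMeasure w Q.half with hb
  have hv0 : v ≠ 0 := Q.volume_half_ne_zero
  have hvt : v ≠ ∞ := Q.volume_half_ne_top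
  have hst : s ≠ ∞ := hσ.weightMeasure_half_ne_top Q
  have hcube : rhoEps σ ε Q * (s / v) ^ (p - 1) * (b / v) ≤ entropyBump σ w p ε := by
    rw [hs, hb, hv, ← hσ.cubeAverage_eq, ← hw.cubeAverage_eq]
    exact le_iSup (fun Q : Cube d =>
      rhoEps σ ε Q * cubeAverage σ Q ^ (p - 1) * cubeAverage w Q) Q
  have hsv : (s / v) ^ (p - 1) ≠ 0 := by
    simp [ENNReal.rpow_eq_zero_iff, ENNReal.div_eq_zero_iff, hσ0, hvt, hp1, not_lt.2 hp1.le]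
  have hbv : b / v ≠ 0 := ENNReal.div_ne_zero.2 ⟨hw0, hvt⟩
  have hrt : rhoEps σ ε Q ≠ ∞ := by
    intro h
    rw [h, ENNReal.top_mul hsv, ENNReal.top_mul hbv] at hcube
    exact hK (top_le_iff.1 hcube)
  have hr0 : rhoEps σ ε Q ≠ 0 := by
    have hr1 : 1 ≤ rho σ Q := hσ.one_le_rho Q (by rw [← weightMeasure_half]; exact hσ0)
    have hρt : rho σ Q ≠ ∞ := fun h => hrt (by simp [rhoEps, h])
    have ht1 : 1 ≤ (rho σ Q).toReal := by
      rw [← ENNReal.toReal_one]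
      exact ENNReal.toReal_mono hρt hr1
    rw [rhoEps, if_neg hρt]
    refine mul_ne_zero (zero_lt_one.trans_le hr1).ne' (ENNReal.ofReal_pos.2 ?_).ne'
    exact hε₀.trans_le (hε1.trans (hmono self_mem_Ici ht1 ht1))
  have hpow : (s / v) ^ p = (s / v) ^ (p - 1) * (s / v) := by
    conv_lhs => rw [show p = (p - 1) + 1 by ring]
    rw [ENNReal.rpow_add_of_nonneg _ _ hp1.le zero_le_one, ENNReal.rpow_one]
  calc (s / v) ^ p * b
      = (rhoEps σ ε Q * (rhoEps σ ε Q)⁻¹) * ((s / v) ^ (p - 1) * (s / v) * b) := by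
        rw [ENNReal.mul_inv_cancel hr0 hrt, one_mul, hpow]
    _ = rhoEps σ ε Q * (s / v) ^ (p - 1) * (b / v) * (s / rhoEps σ ε Q) := by
        simp only [div_eq_mul_inv]; ring
    _ ≤ entropyBump σ w p ε * (s / rhoEps σ ε Q) := by gcongr

/-- The constant of the `L^p` bound for a dyadic maximal function. -/
noncomputable def dyadicConst (p ε₀ : ℝ) : ℝ≥0∞ :=
  2 ^ p * (2 ^ p * (4 * ((ENNReal.ofReal ε₀)⁻¹ + 2)) * geomConst p ^ p)

theorem dyadicConst_ne_top {p ε₀ : ℝ} (hp : 1 < p) (hε₀ : 0 < ε₀) : dyadicConst p ε₀ ≠ ∞ := by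
  have h1 : geomConst p ^ p ≠ ∞ :=
    ENNReal.rpow_ne_top_of_nonneg (by linarith) (geomConst_ne_top hp)
  have h2 : (2 : ℝ≥0∞) ^ p ≠ ∞ := ENNReal.rpow_ne_top_of_nonneg (by linarith) (by simp)
  have h3 : (ENNReal.ofReal ε₀)⁻¹ ≠ ∞ := ENNReal.inv_ne_top.2 (ENNReal.ofReal_pos.2 hε₀).ne'
  unfold dyadicConst
  finiteness

/-- The two-weight bound for the maximal function of one shifted dyadic grid. -/
theorem lintegral_dyadicMaximal_rpow_le {p : ℝ} (hp : 1 < p) {ε₀ : ℝ} (hε₀ : 0 < ε₀) {ε : ℝ → ℝ}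
    (hmono : MonotoneOn ε (Ici 1)) (hε1 : ε₀ ≤ ε 1)
    (hint : ∫⁻ t in Ioi (1 : ℝ), ENNReal.ofReal (1 / (ε t * t)) = 1)
    {σ w : (Fin d → ℝ) → ℝ} (hσ : IsWeight σ) (hw : IsWeight w)
    (hK : entropyBump σ w p ε ≠ ∞) {f : (Fin d → ℝ) → ℝ}
    (hf : MemLp f (ENNReal.ofReal p) (weightMeasure σ)) (u : Fin d → Bool) :
    ∫⁻ x, (⨆ n : ℤ × (Fin d → ℤ), (dyadicCube u n.1 n.2).half.indicator
        (fun _ => cubeAverage (fun x => σ x * f x) (dyadicCube u n.1 n.2)) x) ^ p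
          ∂(weightMeasure w) ≤
      dyadicConst p ε₀ * entropyBump σ w p ε * ∫⁻ x, ‖f x‖ₑ ^ p ∂(weightMeasure σ) := by
  classical
  have hp0 : 0 < p := by linarith
  have hfm : AEMeasurable (fun x => ‖f x‖ₑ) (weightMeasure σ) := hf.1.enorm
  have hcube : ∀ A ∈ dyadicGrid u, ∃ Q : Cube d, Q.half = A := by
    rintro _ ⟨n, rfl⟩
    exact ⟨_, rfl⟩
  have : Nonempty (Cube d) := ⟨⟨0, 1, one_pos⟩⟩
  choose! Q hQ using hcube
  set v : Set (Fin d → ℝ) → ℝ≥0∞ := fun A =>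
    (∫⁻ y in A, ‖f y‖ₑ ∂(weightMeasure σ)) / volume A with hv
  set F : Finset (ℤ × (Fin d → ℤ)) → Finset (Set (Fin d → ℝ)) := fun s =>
    s.image fun n => (dyadicCube u n.1 n.2).half with hFdef
  have hFgrid : ∀ s, ∀ A ∈ F s, A ∈ dyadicGrid u := by
    intro s A hA
    obtain ⟨n, -, rfl⟩ := Finset.mem_image.1 hA
    exact ⟨n, rfl⟩
  have hFm : ∀ s, ∀ A ∈ F s, MeasurableSet A := fun s A hA => by
    rw [← hQ A (hFgrid s A hA)]; exact (Q A).measurableSet_half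
  set H : Finset (ℤ × (Fin d → ℤ)) → (Fin d → ℝ) → ℝ≥0∞ := fun s x =>
    (⨆ A ∈ F s, A.indicator (fun _ => v A) x) ^ p with hH
  have hHm : ∀ s, Measurable (H s) := fun s =>
    (Measurable.biSup _ (F s).countable_toSet fun A hA =>
      measurable_const.indicator (hFm s A hA)).pow_const p
  have hHmono : Monotone H := by
    intro s t hst x
    refine ENNReal.rpow_le_rpow (biSup_mono fun A hA => ?_) hp0.le
    exact Finset.image_subset_image hst hA
  have hpt : ∀ x, (⨆ n : ℤ × (Fin d → ℤ), (dyadicCube u n.1 n.2).half.indicator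
      (fun _ => cubeAverage (fun x => σ x * f x) (dyadicCube u n.1 n.2)) x) ^ p ≤
      ⨆ s, H s x := by
    intro x
    rw [← ENNReal.le_rpow_inv_iff hp0]
    refine iSup_le fun n => ?_
    rw [ENNReal.le_rpow_inv_iff hp0]
    refine le_iSup_of_le {n} (ENNReal.rpow_le_rpow ?_ hp0.le)
    rw [hσ.cubeAverage_mul hfm]
    exact le_iSup₂ (f := fun (A : Set (Fin d → ℝ)) (_ : A ∈ F {n}) => A.indicator (fun _ => v A) x)
      _ (Finset.mem_image_of_mem _ (Finset.mem_singleton_self n))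
  refine (lintegral_mono hpt).trans ?_
  rw [lintegral_iSup_directed (fun s => (hHm s).aemeasurable) hHmono.directed_le]
  refine iSup_le fun s => ?_
  have hQs : ∀ A ∈ F s, (Q A).half = A := fun A hA => hQ A (hFgrid s A hA)
  have hlam : IsLaminar (F s : Set (Set (Fin d → ℝ))) :=
    (isLaminar_dyadicGrid u).mono fun A hA => hFgrid s A hA
  have hσt : ∀ A ∈ F s, weightMeasure σ A ≠ ∞ := fun A hA => by
    rw [← hQs A hA]; exact hσ.weightMeasure_half_ne_top _
  have hfin : ∀ A ∈ F s, ∫⁻ y in A, ‖f y‖ₑ ∂(weightMeasure σ) ≠ ∞ := by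
    intro A hA
    have : IsFiniteMeasure ((weightMeasure σ).restrict A) :=
      ⟨by rw [Measure.restrict_apply_univ]; exact (hσt A hA).lt_top⟩
    have h1 : (1 : ℝ≥0∞) ≤ ENNReal.ofReal p := by
      rw [← ENNReal.ofReal_one]; exact ENNReal.ofReal_le_ofReal hp.le
    exact ((hf.restrict A).integrable h1).hasFiniteIntegral.ne
  refine (lintegral_iSup_average_rpow_le hp volume (weightMeasure σ) (weightMeasure w) (F s) hlam
    (hFm s) (fun A hA => by rw [← hQs A hA]; exact (Q A).volume_half_ne_zero)
    (fun A hA => by rw [← hQs A hA]; exact (Q A).volume_half_ne_top) hσt _ hfm hfin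
    (fun A => rho σ (Q A)) (fun A => weightMeasure σ A / rhoEps σ ε (Q A))
    (fun k => (ENNReal.ofReal (ε (2 ^ k)))⁻¹) (entropyBump σ w p ε) ?_ ?_ ?_).trans ?_
  · intro S hS hsparse R hR _
    convert hσ.sum_le_rho_mul S (hlam.mono hS) Q (fun A hA => hQs A (hS hA)) hsparse hR
  · intro A hA hne
    have := hσ.exists_layer hmono (Q A)
    rw [hQs A hA] at this
    exact this hne
  · intro A hA
    have := hσ.average_rpow_mul_le hw hp hε₀ hmono hε1 hK (Q A)
    rwa [hQs A hA] at this
  · rw [dyadicConst]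
    gcongr
    exact tsum_inv_le_of_lintegral_eq_one hε₀ hmono hε1 hint

/-- The two-weight bound in integral form: the full maximal function is at most `6^d` times the
largest of the `2^d` dyadic ones. -/
theorem lintegral_maximalFunction_rpow_le {p : ℝ} (hp : 1 < p) {ε₀ : ℝ} (hε₀ : 0 < ε₀)
    {ε : ℝ → ℝ} (hmono : MonotoneOn ε (Ici 1)) (hε1 : ε₀ ≤ ε 1)
    (hint : ∫⁻ t in Ioi (1 : ℝ), ENNReal.ofReal (1 / (ε t * t)) = 1)
    {σ w : (Fin d → ℝ) → ℝ} (hσ : IsWeight σ) (hw : IsWeight w)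
    (hK : entropyBump σ w p ε ≠ ∞) {f : (Fin d → ℝ) → ℝ}
    (hf : MemLp f (ENNReal.ofReal p) (weightMeasure σ)) :
    ∫⁻ x, maximalFunction (fun x => σ x * f x) x ^ p ∂(weightMeasure w) ≤
      (6 ^ d) ^ p * (2 ^ d * dyadicConst p ε₀) * entropyBump σ w p ε *
        ∫⁻ x, ‖f x‖ₑ ^ p ∂(weightMeasure σ) := by
  classical
  have hp0 : 0 < p := by linarith
  set G : (Fin d → Bool) → (Fin d → ℝ) → ℝ≥0∞ := fun u x => ⨆ n : ℤ × (Fin d → ℤ),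
    (dyadicCube u n.1 n.2).half.indicator
      (fun _ => cubeAverage (fun x => σ x * f x) (dyadicCube u n.1 n.2)) x with hG
  have hGm : ∀ u, Measurable (G u) := fun u => Measurable.iSup fun n =>
    measurable_const.indicator (Cube.measurableSet_half _)
  have hpt : ∀ x, maximalFunction (fun x => σ x * f x) x ^ p ≤
      (6 ^ d) ^ p * ∑ u : Fin d → Bool, G u x ^ p := by
    intro x
    calc maximalFunction (fun x => σ x * f x) x ^ p ≤ (6 ^ d * ⨆ u, G u x) ^ p :=
          ENNReal.rpow_le_rpow (maximalFunction_le _ x) hp0.le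
      _ = (6 ^ d) ^ p * (⨆ u, G u x) ^ p := ENNReal.mul_rpow_of_nonneg _ _ hp0.le
      _ ≤ _ := by
          gcongr
          rw [← ENNReal.le_rpow_inv_iff hp0]
          refine iSup_le fun u => ?_
          rw [ENNReal.le_rpow_inv_iff hp0]
          exact Finset.single_le_sum (f := fun u => G u x ^ p) (fun _ _ => zero_le)
            (Finset.mem_univ u)
  calc ∫⁻ x, maximalFunction (fun x => σ x * f x) x ^ p ∂(weightMeasure w)
      ≤ ∫⁻ x, (6 ^ d) ^ p * ∑ u : Fin d → Bool, G u x ^ p ∂(weightMeasure w) := lintegral_mono hpt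
    _ = (6 ^ d) ^ p * ∑ u : Fin d → Bool, ∫⁻ x, G u x ^ p ∂(weightMeasure w) := by
        rw [lintegral_const_mul _ (Finset.measurable_fun_sum _ fun u _ => (hGm u).pow_const p),
          lintegral_finsetSum _ fun u _ => (hGm u).pow_const p]
    _ ≤ (6 ^ d) ^ p * ∑ _u : Fin d → Bool, dyadicConst p ε₀ * entropyBump σ w p ε *
          ∫⁻ x, ‖f x‖ₑ ^ p ∂(weightMeasure σ) := by
        refine mul_le_mul_right (Finset.sum_le_sum fun u _ => ?_) _
        exact lintegral_dyadicMaximal_rpow_le hp hε₀ hmono hε1 hint hσ hw hK hf u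
    _ = _ := by
        rw [Finset.sum_const, Finset.card_univ, Fintype.card_fun, Fintype.card_bool,
          Fintype.card_fin, nsmul_eq_mul]
        push_cast
        ring

end

theorem theorem1 (d : ℕ) (hd : 1 ≤ d) (p : ℝ) (hp : 1 < p) (ε₀ : ℝ) (hε₀ : 0 < ε₀) :
    ∃ C : ℝ≥0, ∀ ε : ℝ → ℝ, MonotoneOn ε (Ici 1) → ε₀ ≤ ε 1 →
      ∫⁻ t in Ioi (1 : ℝ), ENNReal.ofReal (1 / (ε t * t)) = 1 →
      ∀ σ w : (Fin d → ℝ) → ℝ, IsWeight σ → IsWeight w →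
        maximalOpNorm σ w p ≤ (C : ℝ≥0∞) * entropyBump σ w p ε ^ (1 / p) := by
  have hp0 : 0 < p := by linarith
  set B : ℝ≥0∞ := (6 ^ d) ^ p * (2 ^ d * dyadicConst p ε₀) with hB
  have hBt : B ^ (1 / p) ≠ ∞ := by
    have h1 := dyadicConst_ne_top hp hε₀
    have h2 : ((6 : ℝ≥0∞) ^ d) ^ p ≠ ∞ :=
      ENNReal.rpow_ne_top_of_nonneg hp0.le (by finiteness)
    exact ENNReal.rpow_ne_top_of_nonneg (by positivity) (by rw [hB]; finiteness)
  -- Adding `1` keeps the constant positive, so that the right-hand side is `∞` when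
  -- `⌈σ, w⌉_{p,ε} = ∞`.
  refine ⟨(B ^ (1 / p)).toNNReal + 1, fun ε hmono hε1 hint σ w hσ hw => ?_⟩
  by_cases hK : entropyBump σ w p ε = ∞
  · rw [hK, ENNReal.top_rpow_of_pos (by positivity), ENNReal.mul_top (by simp)]
    exact le_top
  refine sInf_le fun f hf => ?_
  rw [eLpNorm_eq_lintegral_rpow_enorm_toReal (ENNReal.ofReal_pos.2 hp0).ne' ENNReal.ofReal_ne_top,
    eLpNorm_eq_lintegral_rpow_enorm_toReal (ENNReal.ofReal_pos.2 hp0).ne' ENNReal.ofReal_ne_top,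
    ENNReal.toReal_ofReal hp0.le]
  simp only [enorm_eq_self]
  calc (∫⁻ x, maximalFunction (fun x => σ x * f x) x ^ p ∂(weightMeasure w)) ^ (1 / p)
      ≤ (B * entropyBump σ w p ε * ∫⁻ x, ‖f x‖ₑ ^ p ∂(weightMeasure σ)) ^ (1 / p) :=
        ENNReal.rpow_le_rpow
          (lintegral_maximalFunction_rpow_le hp hε₀ hmono hε1 hint hσ hw hK hf) (by positivity)
    _ = B ^ (1 / p) * entropyBump σ w p ε ^ (1 / p) *
          (∫⁻ x, ‖f x‖ₑ ^ p ∂(weightMeasure σ)) ^ (1 / p) := by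
        rw [ENNReal.mul_rpow_of_nonneg _ _ (by positivity),
          ENNReal.mul_rpow_of_nonneg _ _ (by positivity)]
    _ ≤ _ := by
        gcongr
        rw [ENNReal.coe_add, ENNReal.coe_toNNReal hBt]
        exact le_self_add
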